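/- **Setting.** Let $d\ge 0$ and $N\ge 2$ be integers, and let $E\subset\mathbb{R}^d$ be a bounded measurable set of positive Lebesgue measure (for example a compact set of positive measure). For a design $X=(x_1,\dots,x_N)\in(\mathbb{R}^d)^N$ put $$\delta_X=\min_{i\ne j}\|x_i-x_j\|,\qquad U(X)=\operatorname{diam}(E)-\delta_X .$$ Let $\operatorname{osc}(U)$ be the smallest $h\ge 0$ such that $U(Y)-U(X)\le h$ for all $X,Y\in E^N$. Let $\lambda_N$ be the Lebesgue measure on $(\mathbb{R}^d)^N$ restricted to $E^N$, let $m=\sup\{a\in\mathbb{R}:\lambda_N(\{U<a\})=0\}$ and, for $\varepsilon>0$, let $$U^{\varepsilon}=\{X\in E^N: U(X)\le m+\varepsilon\}.$$ **Algorithm.** Fix a symmetric positive definite $d\times d$ matrix $\Sigma$, a number $\gamma>0$, and real sequences $(\tau_n)_{n\ge0}$ and $(\beta_n)_{n\ge0}$ such that $0<\tau_{\min}\le\tau_n\le\tau_{\max}$ and $\beta_n\ge 0$ for all $n$, where $\tau_{\min},\tau_{\max}$ do not depend on $n$. Given $X^{(n)}=X=(x_1,\dots,x_N)\in E^N$, the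 next state $X^{(n+1)}$ is obtained as follows. 1. A pair $\{i,j\}$, $i\neq j$, is drawn with probability proportional to $1/(\|x_i-x_j\|+\gamma)$, and one of its two indices, called $k$, is chosen with probability $\tfrac12$. 2. A point $x_k^{\mathrm{prop}}$ is drawn from the Gaussian law with mean $x_k$ and covariance $\tau_n\Sigma$ conditioned to lie in $E$; $X^{\mathrm{prop}}$ is $X$ with $x_k$ replaced by $x_k^{\mathrm{prop}}$. 3. $X^{(n+1)}=X^{\mathrm{prop}}$ with probability $\min\bigl(1,\exp(-\beta_n(U(X^{\mathrm{prop}})-U(X)))\bigr)$, and $X^{(n+1)}=X$ otherwise. Thus $(X^{(n)})_{n\ge0}$ is a time-inhomogeneous Markov chain; its initial law is an arbitrary probability distribution on $E^N$. **Proposition.** Suppose that there is a constant $C>N\operatorname{osc}(U)$ such that $$\beta_n\le\frac1C\log(n+e)\qquad\text{for all } n\in\mathbb{N}.$$ Then for every $\varepsilon>0$ the first visit time $T=\inf\{n\ge0: X^{(n)}\in U^{\varepsilon}\}$ has finite expectation: $\mathbb{E}[T]<\infty$. -/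

import Mathlib

open MeasureTheory ProbabilityTheory
open scoped ENNReal

noncomputable section

namespace MaximinDesign

/-- A point of the ambient space `ℝ^d`, with its Euclidean norm. -/
abbrev Point (d : ℕ) : Type := EuclideanSpace ℝ (Fin d)

/-- A configuration of `N` points of `ℝ^d`. -/
abbrev Config (d N : ℕ) : Type := Fin N → Point d

variable {d N : ℕ}

/-- The set `E^N` of designs: all `N` points lie in `E`. -/
def designs (E : Set (Point d)) (N : ℕ) : Set (Config d N) := {X | ∀ i, X i ∈ E}

/-- `δ_X`, the minimal distance between two points of `X` with distinct indices
(a minimum over a finite set, nonempty as soon as `2 ≤ N`). -/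
def minDist (X : Config d N) : ℝ :=
  ⨅ p : {p : Fin N × Fin N // p.1 ≠ p.2}, ‖X p.1.1 - X p.1.2‖

/-- The energy `U(X) = diam(E) - δ_X`. -/
def energy (E : Set (Point d)) (X : Config d N) : ℝ := Metric.diam E - minDist X

/-- `osc(U)`, the smallest `h ≥ 0` such that `U(Y) - U(X) ≤ h` for all `X, Y ∈ E^N`. -/
def osc (E : Set (Point d)) (N : ℕ) : ℝ :=
  sInf {h : ℝ | 0 ≤ h ∧ ∀ X ∈ designs E N, ∀ Y ∈ designs E N, energy E Y - energy E X ≤ h}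

/-- `λ_N`, the Lebesgue measure on `E^N`. -/
def lebesgueDesigns (E : Set (Point d)) (N : ℕ) : Measure (Config d N) :=
  (volume : Measure (Config d N)).restrict (designs E N)

/-- `m = sup {a : λ_N(U < a) = 0}`, the essential infimum of `U`. -/
def essMin (E : Set (Point d)) (N : ℕ) : ℝ :=
  sSup {a : ℝ | lebesgueDesigns E N {X | energy E X < a} = 0}

/-- `U^ε = {X ∈ E^N : U(X) ≤ m + ε}`. -/
def nearOptimal (E : Set (Point d)) (N : ℕ) (ε : ℝ) : Set (Config d N) :=
  {X | X ∈ designs E N ∧ energy E X ≤ essMin E N + ε}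

/-- `φ(y | μ, S)`, the density at `y` of the Gaussian law with mean `μ` and covariance `S`. -/
def gaussianDensity (S : Matrix (Fin d) (Fin d) ℝ) (μ y : Point d) : ℝ :=
  (Real.sqrt ((2 * Real.pi) ^ d * S.det))⁻¹ *
    Real.exp (-(1 / 2) * ((y - μ).ofLp ⬝ᵥ (S⁻¹.mulVec (y - μ).ofLp)))

/-- `G_{μ,S} = ∫_E φ(y | μ, S) dy`. -/
def gaussianMass (E : Set (Point d)) (S : Matrix (Fin d) (Fin d) ℝ) (μ : Point d) : ℝ≥0∞ :=
  ∫⁻ y in E, ENNReal.ofReal (gaussianDensity S μ y)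

/-- `d_{i,j}^X = 1 / (‖x_i - x_j‖ + γ)`. -/
def pairWeight (γ : ℝ) (X : Config d N) (i j : Fin N) : ℝ := 1 / (‖X i - X j‖ + γ)

/-- `D^X = ∑_{k < l} d_{k,l}^X`. -/
def totalWeight (γ : ℝ) (X : Config d N) : ℝ :=
  ∑ k : Fin N, ∑ l : Fin N, if k < l then pairWeight γ X k l else 0

/-- `∑_{j ≠ i} (1/2) d_{i,j}^X / D^X`, the probability that the `i`-th point is the one moved. -/
def selectProb (γ : ℝ) (X : Config d N) (i : Fin N) : ℝ :=
  ∑ j : Fin N, if j ≠ i then (1 / 2) * (pairWeight γ X i j / totalWeight γ X) else 0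

/-- `q_{τ,i}(X, Y) = φ(y_i | x_i, τ S) G_{x_i, τ S}⁻¹ ∑_{j ≠ i} (1/2) d_{i,j}^X / D^X`. -/
def proposalDensity (E : Set (Point d)) (S : Matrix (Fin d) (Fin d) ℝ) (γ τ : ℝ)
    (i : Fin N) (X Y : Config d N) : ℝ≥0∞ :=
  ENNReal.ofReal (gaussianDensity (τ • S) (X i) (Y i)) * (gaussianMass E (τ • S) (X i))⁻¹ *
    ENNReal.ofReal (selectProb γ X i)

/-- `Q_τ(X, dY) = ∑_i q_{τ,i}(X, Y) λ(dy_i) Dir_{X_{-i}}(dY_{-i})`, where `λ` is the Lebesgue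
measure on `E`: only the `i`-th point of `X` is replaced. -/
def proposal (E : Set (Point d)) (S : Matrix (Fin d) (Fin d) ℝ) (γ τ : ℝ)
    (X : Config d N) : Measure (Config d N) :=
  ∑ i : Fin N, Measure.map (fun y : Point d => Function.update X i y)
    (((volume : Measure (Point d)).restrict E).withDensity
      fun y => proposalDensity E S γ τ i X (Function.update X i y))

/-- The acceptance probability `min(1, exp(-β (U(Y) - U(X))))`. -/
def acceptProb (E : Set (Point d)) (β : ℝ) (X Y : Config d N) : ℝ :=
  min 1 (Real.exp (-β * (energy E Y - energy E X)))

/-- The transition law from `X` of one iteration: a proposal `Y` drawn from `Q_τ(X, ·)` is accepted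
with probability `min(1, exp(-β (U(Y) - U(X))))`, otherwise the chain stays at `X`. -/
def transition (E : Set (Point d)) (S : Matrix (Fin d) (Fin d) ℝ) (γ β τ : ℝ)
    (X : Config d N) : Measure (Config d N) :=
  (proposal E S γ τ X).withDensity (fun Y => ENNReal.ofReal (acceptProb E β X Y)) +
    (1 - ∫⁻ Z, ENNReal.ofReal (acceptProb E β X Z) ∂(proposal E S γ τ X)) • Measure.dirac X

/-- `X` is a (time-inhomogeneous) Markov chain under `P` whose conditional law of `X (n + 1)` given
`X 0, …, X n` is `K n (X n)`: for every event `(X 0, …, X n) ∈ B` of the past and every `A`,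
`P(X (n + 1) ∈ A, (X 0, …, X n) ∈ B) = E[K n (X n, A); (X 0, …, X n) ∈ B]`. -/
structure IsMarkovChain {Ω S : Type*} [MeasurableSpace Ω] [MeasurableSpace S]
    (K : ℕ → S → Measure S) (P : Measure Ω) (X : ℕ → Ω → S) : Prop where
  measurable : ∀ n, Measurable (X n)
  transition : ∀ n, ∀ A : Set S, MeasurableSet A →
    ∀ B : Set (Fin (n + 1) → S), MeasurableSet B →
      P {ω | X (n + 1) ω ∈ A ∧ (fun k : Fin (n + 1) => X k ω) ∈ B} =
        ∫⁻ ω in {ω | (fun k : Fin (n + 1) => X k ω) ∈ B}, K n (X n ω) A ∂P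

/-- The first time `n ≥ 0` at which `X n ω ∈ A`, equal to `∞` if there is none. -/
def firstVisit {Ω S : Type*} (X : ℕ → Ω → S) (A : Set S) (ω : Ω) : ℕ∞ :=
  hittingAfter X A 0 ω

end MaximinDesign

end

noncomputable section

namespace MaximinDesign

variable {d N : ℕ}

/-! In `N` consecutive steps the chain can move each point once, all proposals being accepted. On
the bounded set `E` the proposal density for any single point is at least some `κ > 0`, uniformly in
time and state, and a proposal at time `n` is accepted with probability at least `exp(-β n * osc)`.
Keeping only these paths, `N` steps dominate a multiple of `λ_N`, whatever the past
(`le_transition`, `IsMarkovChain.prod_mul_pi_mul_le`).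

Since `U^ε` has positive `λ_N`-measure, after avoiding it up to time `n` the chain is inside it at
time `n + N` with conditional probability at least `c (n + N + e)^(-α)`, where `α = N osc / C < 1`
(`rpow_neg_le_prod_exp`). As `α < 1`, this eventually exceeds `2N / (n + N)`, which makes the
survival probabilities `P(T > n)` summable (`summable_of_shift_le`); their sum is `E[T]`. -/

/-! ### Energy, oscillation and the near-optimal set -/

theorem minDist_nonneg (X : Config d N) : 0 ≤ minDist X :=
  Real.iInf_nonneg fun _ => norm_nonneg _

theorem minDist_le (X : Config d N) {i j : Fin N} (hij : i ≠ j) : minDist X ≤ ‖X i - X j‖ :=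
  ciInf_le (f := fun p : {p : Fin N × Fin N // p.1 ≠ p.2} => ‖X p.1.1 - X p.1.2‖)
    (Set.finite_range _).bddBelow ⟨(i, j), hij⟩

theorem measurable_minDist : Measurable (minDist : Config d N → ℝ) :=
  Measurable.iInf fun p => by fun_prop

theorem measurable_energy (E : Set (Point d)) : Measurable (energy E : Config d N → ℝ) :=
  measurable_const.sub measurable_minDist

theorem designs_eq_pi (E : Set (Point d)) : designs E N = Set.univ.pi fun _ => E := by
  ext X; simp [designs]

theorem measurableSet_designs {E : Set (Point d)} (hE : MeasurableSet E) :
    MeasurableSet (designs E N) := by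
  rw [designs_eq_pi]; exact MeasurableSet.univ_pi fun _ => hE

theorem measurableSet_nearOptimal {E : Set (Point d)} (hE : MeasurableSet E) (ε : ℝ) :
    MeasurableSet (nearOptimal E N ε) :=
  (measurableSet_designs hE).inter (measurableSet_le (measurable_energy E) measurable_const)

theorem update_mem_designs {E : Set (Point d)} {X : Config d N} (hX : X ∈ designs E N)
    (i : Fin N) {y : Point d} (hy : y ∈ E) : Function.update X i y ∈ designs E N := by
  intro j
  rcases eq_or_ne j i with rfl | h
  · simpa using hy
  · simpa [h] using hX j

theorem norm_sub_le_diam {E : Set (Point d)} (hEb : Bornology.IsBounded E) {x y : Point d}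
    (hx : x ∈ E) (hy : y ∈ E) : ‖x - y‖ ≤ Metric.diam E := by
  rw [← dist_eq_norm]; exact Metric.dist_le_diam_of_mem hEb hx hy

theorem osc_nonneg (E : Set (Point d)) : 0 ≤ osc E N :=
  Real.sInf_nonneg fun _ h => h.1

theorem energy_sub_le_osc (hN : 2 ≤ N) {E : Set (Point d)} (hEb : Bornology.IsBounded E)
    {X Y : Config d N} (hX : X ∈ designs E N) (hY : Y ∈ designs E N) :
    energy E Y - energy E X ≤ osc E N := by
  refine le_csInf ⟨Metric.diam E, Metric.diam_nonneg, fun X hX Y hY => ?_⟩ fun h hh => hh.2 X hX Y hY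
  have hij : (⟨0, by omega⟩ : Fin N) ≠ ⟨1, by omega⟩ := by simp
  have h1 := (minDist_le X hij).trans (norm_sub_le_diam hEb (hX _) (hX _))
  have h2 := minDist_nonneg Y
  simp only [energy]; linarith

theorem acceptProb_ge (hN : 2 ≤ N) {E : Set (Point d)} (hEb : Bornology.IsBounded E)
    {β : ℝ} (hβ : 0 ≤ β) {X Y : Config d N} (hX : X ∈ designs E N) (hY : Y ∈ designs E N) :
    Real.exp (-(β * osc E N)) ≤ acceptProb E β X Y := by
  have h := energy_sub_le_osc hN hEb hX hY
  have h0 := mul_nonneg hβ (osc_nonneg (N := N) E)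
  refine le_min (Real.exp_le_one_iff.2 (by linarith)) (Real.exp_le_exp.2 ?_)
  nlinarith

theorem volume_lt_top {E : Set (Point d)} (hEb : Bornology.IsBounded E) : volume E < ⊤ :=
  hEb.measure_lt_top

theorem lebesgueDesigns_eq_pi (E : Set (Point d)) :
    lebesgueDesigns E N = Measure.pi fun _ : Fin N => (volume : Measure (Point d)).restrict E := by
  rw [lebesgueDesigns, designs_eq_pi, volume_pi, Measure.restrict_pi_pi]

theorem lebesgueDesigns_univ_pos {E : Set (Point d)} (hEpos : 0 < volume E) :
    0 < lebesgueDesigns E N Set.univ := by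
  rw [lebesgueDesigns_eq_pi, Measure.pi_univ]
  simp [pos_iff_ne_zero, hEpos.ne']

theorem lebesgueDesigns_lt_top {E : Set (Point d)} (hEb : Bornology.IsBounded E)
    (A : Set (Config d N)) : lebesgueDesigns E N A < ⊤ := by
  refine (measure_mono (Set.subset_univ A)).trans_lt ?_
  rw [lebesgueDesigns_eq_pi, Measure.pi_univ]
  exact ENNReal.prod_lt_top fun _ _ => by simpa using volume_lt_top hEb

/-- Otherwise `m + ε` would belong to the set whose supremum is `m`. -/
theorem lebesgueDesigns_nearOptimal_pos {E : Set (Point d)} (hE : MeasurableSet E)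
    (hEpos : 0 < volume E) {ε : ℝ} (hε : 0 < ε) :
    0 < lebesgueDesigns E N (nearOptimal E N ε) := by
  rw [pos_iff_ne_zero]
  intro h0
  have hmem : lebesgueDesigns E N {X | energy E X < essMin E N + ε} = 0 := by
    rw [lebesgueDesigns, Measure.restrict_apply (measurableSet_lt (measurable_energy E)
      measurable_const)]
    rw [lebesgueDesigns, Measure.restrict_apply (measurableSet_nearOptimal hE ε)] at h0
    refine measure_mono_null ?_ h0
    rintro X ⟨hlt, hX⟩
    exact ⟨⟨hX, le_of_lt hlt⟩, hX⟩
  -- Boundedness makes `sSup` a genuine supremum: `U ≤ diam E`, so for `a > diam E` the sublevel set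
  -- is everything and is not null.
  have hbdd : BddAbove {a : ℝ | lebesgueDesigns E N {X | energy E X < a} = 0} := by
    refine ⟨Metric.diam E, fun a ha => ?_⟩
    by_contra! hlt
    refine (lebesgueDesigns_univ_pos (N := N) hEpos).ne' (measure_mono_null (fun X _ => ?_) ha)
    have := minDist_nonneg X
    simp only [energy, Set.mem_ofPred_eq]; linarith
  have := le_csSup hbdd hmem
  rw [essMin] at this
  linarith

/-! ### Uniform minorization of the proposal and of one transition -/

/-- A lower bound, uniform in the scale `τ`, for the truncated Gaussian density on a bounded set. -/
theorem exists_le_truncated_gaussian {E : Set (Point d)}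
    (hEb : Bornology.IsBounded E)
    {S : Matrix (Fin d) (Fin d) ℝ} (hS : S.PosDef) {τmin : ℝ} (hτmin : 0 < τmin) :
    ∃ κ : ℝ, 0 < κ ∧ ∀ τ, τmin ≤ τ → ∀ x ∈ E, ∀ y ∈ E,
      ENNReal.ofReal κ ≤ ENNReal.ofReal (gaussianDensity (τ • S) x y) *
        (gaussianMass E (τ • S) x)⁻¹ := by
  have hcont : Continuous fun v : Point d => v.ofLp ⬝ᵥ (S⁻¹.mulVec v.ofLp) := by
    fun_prop
  obtain ⟨M, hM⟩ := (isCompact_closedBall (0 : Point d) (Metric.diam E)).exists_bound_of_continuousOn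
    hcont.continuousOn
  set V := (volume E).toReal
  have hV : 0 ≤ V := ENNReal.toReal_nonneg
  -- The Gaussian normalization `Z` bounds the density from above, so the mass of `E` is at most `Z
  -- * (V + 1)`, and `Z` cancels in the quotient. Writing `V + 1` keeps the divisor positive.
  set κ := Real.exp (-(1 / 2) * (τmin⁻¹ * |M|)) * (V + 1)⁻¹
  refine ⟨κ, by positivity, fun τ hτ x hx y hy => ?_⟩
  have hτ0 : 0 < τ := hτmin.trans_le hτ
  have hinv : (τ • S)⁻¹ = τ⁻¹ • S⁻¹ :=
    Matrix.inv_smul' S (Units.mk0 τ hτ0.ne') hS.det_pos.ne'.isUnit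
  have hquad (z : Point d) : (z - x).ofLp ⬝ᵥ ((τ • S)⁻¹.mulVec (z - x).ofLp) =
      τ⁻¹ * ((z - x).ofLp ⬝ᵥ (S⁻¹.mulVec (z - x).ofLp)) := by
    rw [hinv, Matrix.smul_mulVec, dotProduct_smul, smul_eq_mul]
  have hdet : 0 < (τ • S).det := by
    rw [Matrix.det_smul]; exact mul_pos (by positivity) hS.det_pos
  set Z := (Real.sqrt ((2 * Real.pi) ^ d * (τ • S).det))⁻¹
  have hZ : 0 < Z := by positivity
  have hlow : Z * Real.exp (-(1 / 2) * (τmin⁻¹ * |M|)) ≤ gaussianDensity (τ • S) x y := by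
    refine mul_le_mul_of_nonneg_left (Real.exp_le_exp.2 ?_) hZ.le
    rw [hquad]
    have h1 := hM (y - x) (by simpa using norm_sub_le_diam hEb hy hx)
    have h2 : (y - x).ofLp ⬝ᵥ (S⁻¹.mulVec (y - x).ofLp) ≤ |M| :=
      (le_abs_self _).trans (h1.trans (le_abs_self _))
    have h3 : τ⁻¹ * ((y - x).ofLp ⬝ᵥ (S⁻¹.mulVec (y - x).ofLp)) ≤ τmin⁻¹ * |M| :=
      (mul_le_mul_of_nonneg_left h2 (by positivity)).trans
        (mul_le_mul_of_nonneg_right (inv_anti₀ hτmin hτ) (abs_nonneg _))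
    linarith
  have hup (z : Point d) : gaussianDensity (τ • S) x z ≤ Z := by
    refine mul_le_of_le_one_right hZ.le (Real.exp_le_one_iff.2 ?_)
    rw [hquad]
    have := hS.inv.posSemidef.dotProduct_mulVec_nonneg (z - x).ofLp
    rw [star_trivial] at this
    have := mul_nonneg (inv_nonneg.2 hτ0.le) this
    linarith
  have hmass : gaussianMass E (τ • S) x ≤ ENNReal.ofReal (Z * (V + 1)) := by
    calc gaussianMass E (τ • S) x ≤ ∫⁻ _ in E, ENNReal.ofReal Z :=
          lintegral_mono fun z => ENNReal.ofReal_le_ofReal (hup z)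
      _ = ENNReal.ofReal Z * ENNReal.ofReal V := by
          rw [setLIntegral_const, ENNReal.ofReal_toReal (volume_lt_top hEb).ne]
      _ ≤ _ := by
          rw [← ENNReal.ofReal_mul hZ.le]
          exact ENNReal.ofReal_le_ofReal (by nlinarith)
  calc ENNReal.ofReal κ
      = ENNReal.ofReal (Z * Real.exp (-(1 / 2) * (τmin⁻¹ * |M|))) *
          (ENNReal.ofReal (Z * (V + 1)))⁻¹ := by
        rw [← ENNReal.ofReal_inv_of_pos (by positivity), ← ENNReal.ofReal_mul (by positivity)]
        congr 1
        simp only [κ]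
        field_simp
    _ ≤ _ := mul_le_mul' (ENNReal.ofReal_le_ofReal hlow) (ENNReal.inv_le_inv.2 hmass)

theorem exists_le_selectProb (hN : 2 ≤ N) {E : Set (Point d)} (hEb : Bornology.IsBounded E)
    {γ : ℝ} (hγ : 0 < γ) :
    ∃ s : ℝ, 0 < s ∧ ∀ X ∈ designs E N, ∀ i, s ≤ selectProb γ X i := by
  have hD : 0 ≤ Metric.diam E := Metric.diam_nonneg
  have hN0 : (0 : ℝ) < N := by exact_mod_cast (by omega : 0 < N)
  -- A single summand `j ≠ i` suffices: its weight is at least `1 / (diam E + γ)`, and the total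
  -- weight has at most `N * N` terms, each at most `1 / γ`.
  refine ⟨(1 / 2) * ((1 / (Metric.diam E + γ)) / (N * (N * (1 / γ)))), by positivity,
    fun X hX i => ?_⟩
  have hpos (a b : Fin N) : 0 < pairWeight γ X a b := by
    unfold pairWeight; positivity
  have hlow (a b : Fin N) : 1 / (Metric.diam E + γ) ≤ pairWeight γ X a b :=
    one_div_le_one_div_of_le (by positivity)
      (by linarith [norm_sub_le_diam hEb (hX a) (hX b)])
  have hup (a b : Fin N) : pairWeight γ X a b ≤ 1 / γ :=
    one_div_le_one_div_of_le hγ (by linarith [norm_nonneg (X a - X b)])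
  have htot_le : totalWeight γ X ≤ N * (N * (1 / γ)) := by
    calc totalWeight γ X ≤ ∑ _k : Fin N, ∑ _l : Fin N, 1 / γ := by
          refine Finset.sum_le_sum fun k _ => Finset.sum_le_sum fun l _ => ?_
          split_ifs
          · exact hup k l
          · positivity
      _ = _ := by simp
  have hterm (k l : Fin N) : 0 ≤ if k < l then pairWeight γ X k l else 0 := by
    split_ifs
    exacts [(hpos k l).le, le_rfl]
  have htot_pos : 0 < totalWeight γ X := by
    have h01 : (⟨0, by omega⟩ : Fin N) < ⟨1, by omega⟩ := by simp
    have h := (Finset.single_le_sum (fun l _ => hterm ⟨0, by omega⟩ l)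
      (Finset.mem_univ (⟨1, by omega⟩ : Fin N))).trans (Finset.single_le_sum
        (f := fun k => ∑ l, if k < l then pairWeight γ X k l else 0)
        (fun k _ => Finset.sum_nonneg fun l _ => hterm k l)
        (Finset.mem_univ (⟨0, by omega⟩ : Fin N)))
    rw [if_pos h01] at h
    exact (hpos _ _).trans_le h
  have : Nontrivial (Fin N) := Fin.nontrivial_iff_two_le.2 hN
  obtain ⟨j, hj⟩ := exists_ne i
  have h := Finset.single_le_sum
    (f := fun j => if j ≠ i then (1 / 2) * (pairWeight γ X i j / totalWeight γ X) else 0)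
    (fun l _ => by
      have := (hpos i l).le
      split_ifs <;> positivity) (Finset.mem_univ j)
  rw [if_pos hj] at h
  refine le_trans ?_ h
  have := div_le_div₀ (hpos i j).le (hlow i j) htot_pos htot_le
  linarith

theorem exists_le_proposalDensity (hN : 2 ≤ N) {E : Set (Point d)}
    (hEb : Bornology.IsBounded E) {S : Matrix (Fin d) (Fin d) ℝ} (hS : S.PosDef)
    {γ : ℝ} (hγ : 0 < γ) {τmin : ℝ} (hτmin : 0 < τmin) :
    ∃ κ : ℝ, 0 < κ ∧ ∀ τ, τmin ≤ τ → ∀ X ∈ designs E N, ∀ i, ∀ y ∈ E,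
      ENNReal.ofReal κ ≤ proposalDensity E S γ τ i X (Function.update X i y) := by
  obtain ⟨κ, hκ, h⟩ := exists_le_truncated_gaussian hEb hS hτmin
  obtain ⟨s, hs, h'⟩ := exists_le_selectProb hN hEb hγ
  refine ⟨κ * s, by positivity, fun τ hτ X hX i y hy => ?_⟩
  rw [ENNReal.ofReal_mul hκ.le, proposalDensity, Function.update_self]
  exact mul_le_mul' (h τ hτ _ (hX i) _ hy) (ENNReal.ofReal_le_ofReal (h' X hX i))

/-- Only accepted moves of the `i`-th point are counted; moves of other points and the rejection
mass are dropped. -/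
theorem le_transition (hN : 2 ≤ N) {E : Set (Point d)} (hE : MeasurableSet E)
    (hEb : Bornology.IsBounded E) {S : Matrix (Fin d) (Fin d) ℝ} {γ β τ κ : ℝ} (hβ : 0 ≤ β)
    {X : Config d N} (hX : X ∈ designs E N) (i : Fin N)
    (hκ : ∀ y ∈ E, ENNReal.ofReal κ ≤ proposalDensity E S γ τ i X (Function.update X i y))
    {A : Set (Config d N)} (hA : MeasurableSet A) :
    ENNReal.ofReal (Real.exp (-(β * osc E N))) * ENNReal.ofReal κ *
        volume.restrict E {y | Function.update X i y ∈ A} ≤ transition E S γ β τ X A := by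
  have hD := measurableSet_designs (N := N) hE
  have hu : Measurable fun y : Point d => Function.update X i y := measurable_update X
  have hprop : ENNReal.ofReal κ * volume.restrict E {y | Function.update X i y ∈ A} ≤
      proposal E S γ τ X (A ∩ designs E N) := by
    have hpre := hu (hA.inter hD)
    rw [proposal, Measure.finsetSum_apply]
    refine le_trans ?_ (Finset.single_le_sum (fun _ _ => zero_le) (Finset.mem_univ i))
    rw [Measure.map_apply hu (hA.inter hD), withDensity_apply _ hpre]
    have hset : volume.restrict E {y | Function.update X i y ∈ A} ≤ volume.restrict E
        ((fun y : Point d => Function.update X i y) ⁻¹' (A ∩ designs E N)) := by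
      refine measure_mono_ae ?_
      filter_upwards [ae_restrict_mem hE] with y hy hyA
      exact ⟨hyA, update_mem_designs hX i hy⟩
    refine (mul_le_mul_right hset _).trans ?_
    rw [← setLIntegral_const]
    refine lintegral_mono_ae ?_
    filter_upwards [ae_restrict_of_ae (ae_restrict_mem hE)] with y hy using hκ y hy
  rw [transition, Measure.add_apply, withDensity_apply _ hA]
  refine le_trans ?_ le_self_add
  calc _ ≤ ENNReal.ofReal (Real.exp (-(β * osc E N))) *
        proposal E S γ τ X (A ∩ designs E N) := by
          rw [mul_assoc]; exact mul_le_mul_right hprop _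
    _ ≤ ∫⁻ Y in A ∩ designs E N, ENNReal.ofReal (acceptProb E β X Y) ∂proposal E S γ τ X := by
        rw [← setLIntegral_const]
        refine lintegral_mono_ae ?_
        filter_upwards [ae_restrict_mem (hA.inter hD)] with Y hY
        exact ENNReal.ofReal_le_ofReal (acceptProb_ge hN hEb hβ hX hY.2)
    _ ≤ _ := lintegral_mono_set Set.inter_subset_left

theorem transition_compl_designs {E : Set (Point d)} (hE : MeasurableSet E)
    {S : Matrix (Fin d) (Fin d) ℝ} {γ β τ : ℝ} {X : Config d N} (hX : X ∈ designs E N) :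
    transition E S γ β τ X (designs E N)ᶜ = 0 := by
  have hD := (measurableSet_designs (N := N) hE).compl
  have hprop : proposal E S γ τ X (designs E N)ᶜ = 0 := by
    rw [proposal, Measure.finsetSum_apply, Finset.sum_eq_zero]
    intro i _
    have hu : Measurable fun y : Point d => Function.update X i y := measurable_update X
    rw [Measure.map_apply hu hD]
    refine withDensity_absolutelyContinuous _ _ ?_
    refine (ae_restrict_mem hE).mono fun y hy => ?_
    simpa [designs] using fun j => update_mem_designs hX i hy j
  rw [transition, Measure.add_apply, withDensity_absolutelyContinuous _ _ hprop,
    Measure.smul_apply, Measure.dirac_apply' _ hD]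
  simp [hX]

/-! ### Chains whose steps dominate the resampling of one coordinate -/

section MarkovChain

variable {Ω S : Type*} [MeasurableSpace S]

/-- `B` is an event about `X 0, …, X n`. -/
def IsPastEvent (X : ℕ → Ω → S) (n : ℕ) (B : Set Ω) : Prop :=
  ∃ B' : Set (Fin (n + 1) → S), MeasurableSet B' ∧ B = {ω | (fun k : Fin (n + 1) => X k ω) ∈ B'}

theorem IsPastEvent.succ {X : ℕ → Ω → S} {n : ℕ} {B : Set Ω} (hB : IsPastEvent X n B) :
    IsPastEvent X (n + 1) B := by
  obtain ⟨B', hB', rfl⟩ := hB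
  have hm : Measurable fun (z : Fin (n + 2) → S) (k : Fin (n + 1)) => z k.castSucc := by fun_prop
  exact ⟨_, hm hB', rfl⟩

theorem isPastEvent_univ (X : ℕ → Ω → S) (n : ℕ) : IsPastEvent X n Set.univ :=
  ⟨Set.univ, .univ, by simp⟩

theorem isPastEvent_avoid (X : ℕ → Ω → S) (n : ℕ) {A : Set S} (hA : MeasurableSet A) :
    IsPastEvent X n {ω | ∀ k ≤ n, X k ω ∉ A} := by
  refine ⟨Set.univ.pi fun _ => Aᶜ, .univ_pi fun _ => hA.compl, ?_⟩
  ext ω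
  refine ⟨fun h k _ => h k (by omega), fun h k hk => h ⟨k, by omega⟩ (Set.mem_univ _)⟩

variable [MeasurableSpace Ω] {K : ℕ → S → Measure S} {P : Measure Ω} {X : ℕ → Ω → S}

theorem IsPastEvent.measurableSet (hX : IsMarkovChain K P X) {n : ℕ} {B : Set Ω}
    (hB : IsPastEvent X n B) : MeasurableSet B := by
  obtain ⟨B', hB', rfl⟩ := hB
  exact measurable_pi_lambda (fun ω (k : Fin (n + 1)) => X k ω) (fun k => hX.measurable k) hB'

theorem IsMarkovChain.measure_inter (hX : IsMarkovChain K P X) {n : ℕ} {B : Set Ω}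
    (hB : IsPastEvent X n B) {A : Set S} (hA : MeasurableSet A) :
    P (X (n + 1) ⁻¹' A ∩ B) = ∫⁻ ω in B, K n (X n ω) A ∂P := by
  obtain ⟨B', hB', rfl⟩ := hB
  exact hX.transition n A hA B' hB'

/-- An almost surely absorbing set is never left. -/
theorem IsMarkovChain.ae_mem (hX : IsMarkovChain K P X) {D : Set S} (hD : MeasurableSet D)
    (h0 : ∀ᵐ ω ∂P, X 0 ω ∈ D) (hK : ∀ n, ∀ x ∈ D, K n x Dᶜ = 0) (n : ℕ) :
    ∀ᵐ ω ∂P, X n ω ∈ D := by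
  induction n with
  | zero => exact h0
  | succ n ih =>
    have h := hX.measure_inter (isPastEvent_univ X n) hD.compl
    rw [Measure.restrict_univ, lintegral_congr_ae (g := 0) (ih.mono fun ω hω => hK n _ hω),
      Set.inter_univ] at h
    simpa using measure_eq_zero_iff_ae_notMem.1 (h.trans (by simp))

/-- If the kernel dominates `a` times the image of `ν` under `φ x`, one step of the chain
dominates the corresponding integral. -/
theorem IsMarkovChain.lintegral_step [SFinite P] (hX : IsMarkovChain K P X)
    {α : Type*} [MeasurableSpace α] {ν : Measure α} [SFinite ν] {φ : S → α → S}
    (hφ : Measurable (Function.uncurry φ)) {a : ℝ≥0∞} {n : ℕ}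
    (h : ∀ᵐ ω ∂P, ∀ A, MeasurableSet A → a * ν {y | φ (X n ω) y ∈ A} ≤ K n (X n ω) A)
    {B : Set Ω} (hB : IsPastEvent X n B) {f : S → ℝ≥0∞} (hf : Measurable f) :
    a * ∫⁻ ω in B, ∫⁻ y, f (φ (X n ω) y) ∂ν ∂P ≤ ∫⁻ ω in B, f (X (n + 1) ω) ∂P := by
  have hψ : Measurable fun p : Ω × α => φ (X n p.1) p.2 :=
    hφ.comp (((hX.measurable n).comp measurable_fst).prodMk measurable_snd)
  -- Comparing joint push-forwards, rather than integrating `f` against `K n x`, avoids any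
  -- measurability of the kernel in `x`.
  have hle : a • ((P.restrict B).prod ν).map (fun p => φ (X n p.1) p.2) ≤
      (P.restrict B).map (X (n + 1)) := by
    refine Measure.le_iff.2 fun A hA => ?_
    have hm := hψ hA
    rw [Measure.smul_apply, smul_eq_mul, Measure.map_apply hψ hA,
      Measure.map_apply (hX.measurable _) hA, Measure.restrict_apply (hX.measurable _ hA),
      hX.measure_inter hB hA, Measure.prod_apply hm,
      ← lintegral_const_mul _ (measurable_measure_prodMk_left hm)]
    exact lintegral_mono_ae (ae_restrict_of_ae (h.mono fun ω hω => hω A hA))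
  calc _ = ∫⁻ x, f x ∂(a • ((P.restrict B).prod ν).map (fun p => φ (X n p.1) p.2)) := by
        rw [lintegral_smul_measure, smul_eq_mul, lintegral_map hf hψ,
          lintegral_prod (fun p => f (φ (X n p.1) p.2)) (hf.comp hψ).aemeasurable]
    _ ≤ _ := lintegral_mono' hle le_rfl
    _ = _ := lintegral_map hf (hX.measurable _)

end MarkovChain

/-- Each coordinate of `s` is resampled from `ν` in one step of its own. In the induction the
inserted coordinate moves at step `n`, and `s` is handled from time `n + 1`, for which `B` is still
a past event. -/
theorem IsMarkovChain.prod_mul_lintegral_lmarginal {ι α Ω : Type*} [DecidableEq ι] [Finite ι]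
    [MeasurableSpace α] [MeasurableSpace Ω] {K : ℕ → (ι → α) → Measure (ι → α)} {P : Measure Ω}
    [SFinite P] {X : ℕ → Ω → ι → α} (hX : IsMarkovChain K P X) {ν : Measure α} [SigmaFinite ν]
    {a : ℕ → ℝ≥0∞}
    (h : ∀ n i, ∀ᵐ ω ∂P, ∀ A, MeasurableSet A →
      a n * ν {y | Function.update (X n ω) i y ∈ A} ≤ K n (X n ω) A)
    (s : Finset ι) {f : (ι → α) → ℝ≥0∞} (hf : Measurable f) (n : ℕ) {B : Set Ω}
    (hB : IsPastEvent X n B) :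
    (∏ l ∈ Finset.range s.card, a (n + l)) * ∫⁻ ω in B, (∫⋯∫⁻_s, f ∂fun _ => ν) (X n ω) ∂P ≤
      ∫⁻ ω in B, f (X (n + s.card) ω) ∂P := by
  induction s using Finset.induction generalizing n with
  | empty => simp
  | insert i s hi ih =>
    have hu : Measurable (Function.uncurry fun (x : ι → α) (y : α) => Function.update x i y) := by
      refine measurable_pi_lambda _ fun j => ?_
      rcases eq_or_ne j i with rfl | hj
      · simpa [Function.uncurry_def] using measurable_snd
      · simp only [Function.uncurry_def, Function.update_of_ne hj]
        fun_prop
    have hstep := hX.lintegral_step hu (h n i) hB (hf.lmarginal (s := s) fun _ => ν)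
    have hih := ih (n + 1) hB.succ
    rw [Finset.card_insert_of_notMem hi, Finset.prod_range_succ', mul_assoc]
    simp_rw [lmarginal_insert f hf hi]
    calc _ ≤ (∏ l ∈ Finset.range s.card, a (n + (l + 1))) *
          ∫⁻ ω in B, (∫⋯∫⁻_s, f ∂fun _ => ν) (X (n + 1) ω) ∂P := mul_le_mul_right hstep _
      _ ≤ _ := by
          simpa only [add_assoc, add_comm 1] using hih

/-- Once all coordinates have been resampled the starting state is forgotten: the full marginal is
the constant `Measure.pi (fun _ => ν) A`. -/
theorem IsMarkovChain.prod_mul_pi_mul_le {ι α Ω : Type*} [DecidableEq ι] [Fintype ι]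
    [MeasurableSpace α] [MeasurableSpace Ω] {K : ℕ → (ι → α) → Measure (ι → α)} {P : Measure Ω}
    [SFinite P] {X : ℕ → Ω → ι → α} (hX : IsMarkovChain K P X) {ν : Measure α} [SigmaFinite ν]
    {a : ℕ → ℝ≥0∞}
    (h : ∀ n i, ∀ᵐ ω ∂P, ∀ A, MeasurableSet A →
      a n * ν {y | Function.update (X n ω) i y ∈ A} ≤ K n (X n ω) A)
    {A : Set (ι → α)} (hA : MeasurableSet A) (n : ℕ) {B : Set Ω} (hB : IsPastEvent X n B) :
    (∏ l ∈ Finset.range (Fintype.card ι), a (n + l)) * (Measure.pi (fun _ => ν) A * P B) ≤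
      P (X (n + Fintype.card ι) ⁻¹' A ∩ B) := by
  have := hX.prod_mul_lintegral_lmarginal h Finset.univ
    (f := A.indicator 1) (measurable_one.indicator hA) n hB
  rw [lmarginal_univ] at this
  simp only [lintegral_indicator_one hA, lintegral_const, Measure.restrict_apply_univ,
    Finset.card_univ] at this
  refine this.trans_eq ?_
  rw [← Measure.restrict_apply (hX.measurable _ hA), ← lintegral_indicator_one (hX.measurable _ hA)]
  rfl

/-! ### Summability and the expected visit time -/

/-- A nonnegative sequence with `p (n + N) ≤ (1 - b n) p n` is summable as soon as eventually
`b n ≥ 2 N / (n + N)`. -/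
theorem summable_of_shift_le {p b : ℕ → ℝ} (hp : ∀ n, 0 ≤ p n) {N : ℕ} (hN : 0 < N)
    (hrec : ∀ n, b n * p n ≤ p n - p (n + N)) {n₀ : ℕ}
    (hb : ∀ n ≥ n₀, 2 * (N : ℝ) ≤ (n + N) * b n) : Summable p := by
  rw [← summable_nat_add_iff n₀]
  -- A Lyapunov function: shifting the window of length `N` trades `n * p n` for `(n + N) * p (n +
  -- N)`.
  set W : ℕ → ℝ := fun n => ∑ k ∈ Finset.range N, ((n + k : ℕ) : ℝ) * p (n + k)
  have hN' : (0 : ℝ) < N := by exact_mod_cast hN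
  have hW (n : ℕ) : 0 ≤ W n := Finset.sum_nonneg fun k _ => mul_nonneg (by positivity) (hp _)
  have hWsucc (n : ℕ) : W (n + 1) + n * p n = W n + (n + N) * p (n + N) := by
    have h1 := Finset.sum_range_succ (fun k => ((n + k : ℕ) : ℝ) * p (n + k)) N
    have h2 := Finset.sum_range_succ' (fun k => ((n + k : ℕ) : ℝ) * p (n + k)) N
    have h3 : W (n + 1) = ∑ k ∈ Finset.range N, ((n + (k + 1) : ℕ) : ℝ) * p (n + (k + 1)) :=
      Finset.sum_congr rfl fun k _ => by rw [show n + 1 + k = n + (k + 1) by omega]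
    rw [h3]
    push_cast at h1 h2 ⊢
    simp only [W]
    push_cast
    simp only [add_zero] at h2
    linarith
  -- The decrease is `(n + N) * (p n - p (n + N)) - N * p n ≥ 2N * p n - N * p n`; the factor 2 in
  -- `hb` pays for the growth of the weights. Telescoping then bounds the sum of `p`.
  have hstep (n : ℕ) (hn : n₀ ≤ n) : N * p n ≤ W n - W (n + 1) := by
    have h1 := mul_le_mul_of_nonneg_right (hb n hn) (hp n)
    have h2 := mul_le_mul_of_nonneg_left (hrec n) (by positivity : (0 : ℝ) ≤ n + N)
    have h3 := hWsucc n
    nlinarith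
  refine summable_of_sum_range_le (c := W n₀ / N) (fun n => hp _) fun M => ?_
  rw [le_div_iff₀ hN']
  have key : (∑ m ∈ Finset.range M, p (m + n₀)) * N ≤ W n₀ - W (n₀ + M) := by
    induction M with
    | zero => simp
    | succ M ih =>
      have := hstep (n₀ + M) (by omega)
      rw [Finset.sum_range_succ, add_mul, add_comm M n₀]
      rw [← add_assoc]
      linarith
  linarith [hW (n₀ + M)]

theorem exists_forall_le_mul_rpow {c : ℝ} (hc : 0 < c) {α : ℝ} (hα : α < 1) (N : ℕ) (hN : 2 ≤ N) :
    ∃ n₀ : ℕ, ∀ n ≥ n₀,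
      2 * (N : ℝ) ≤ ((n : ℝ) + N) * (c * ((n : ℝ) + N + Real.exp 1) ^ (-α)) := by
  have ht : Filter.Tendsto (fun n : ℕ => ((n : ℝ) + N + Real.exp 1) ^ (1 - α))
      Filter.atTop Filter.atTop :=
    (tendsto_rpow_atTop (by linarith)).comp (Filter.tendsto_atTop_add_const_right _ _
      (Filter.tendsto_atTop_add_const_right _ _ tendsto_natCast_atTop_atTop))
  -- Here `8 = 2 * 4`, the 4 coming from `n + N + e ≤ 4 (n + N)`.
  obtain ⟨n₀, h⟩ := Filter.eventually_atTop.1 (ht.eventually_ge_atTop (8 * N / c))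
  refine ⟨n₀, fun n hn => ?_⟩
  have h1 := h n hn
  have hN' : (2 : ℝ) ≤ N := by exact_mod_cast hN
  have hn' : (0 : ℝ) ≤ n := Nat.cast_nonneg n
  have he := Real.exp_one_lt_d9
  have he0 := Real.exp_pos 1
  set x : ℝ := (n : ℝ) + N + Real.exp 1
  have hx : 0 < x := by positivity
  rw [sub_eq_add_neg, Real.rpow_add hx, Real.rpow_one, div_le_iff₀ hc] at h1
  have hx4 : x ≤ 4 * (n + N) := by simp only [x]; linarith
  have := mul_le_mul_of_nonneg_right hx4 (mul_nonneg (Real.rpow_nonneg hx.le (-α)) hc.le)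
  nlinarith

/-- The tail-sum formula: `T` counts the `n` with `T > n`. Without a visit every indicator is 1 and
the sum is infinite. -/
theorem firstVisit_le_tsum {Ω S : Type*} (X : ℕ → Ω → S) (A : Set S) (ω : Ω) :
    (firstVisit X A ω : ℝ≥0∞) ≤
      ∑' n, Set.indicator {ω | ∀ k ≤ n, X k ω ∉ A} (1 : Ω → ℝ≥0∞) ω := by
  by_cases h : ∃ n, X n ω ∈ A
  · classical
    have hle : firstVisit X A ω ≤ (Nat.find h : ℕ∞) :=
      hittingAfter_le_of_mem (Nat.zero_le _) (Nat.find_spec h)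
    calc (firstVisit X A ω : ℝ≥0∞) ≤ ((Nat.find h : ℕ∞) : ℝ≥0∞) := by exact_mod_cast hle
      _ = ∑ n ∈ Finset.range (Nat.find h),
          Set.indicator {ω | ∀ k ≤ n, X k ω ∉ A} (1 : Ω → ℝ≥0∞) ω := by
        rw [Finset.sum_congr rfl (g := fun _ => 1)]
        · simp
        · intro n hn
          have hmem : ω ∈ {ω | ∀ k ≤ n, X k ω ∉ A} := fun k hk =>
            Nat.find_min h (hk.trans_lt (Finset.mem_range.1 hn))
          exact Set.indicator_of_mem hmem _
      _ ≤ _ := ENNReal.sum_le_tsum _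
  · push Not at h
    have hmem (n : ℕ) : ω ∈ {ω | ∀ k ≤ n, X k ω ∉ A} := fun k _ => h k
    rw [tsum_congr (g := fun _ => (1 : ℝ≥0∞)) fun n => Set.indicator_of_mem (hmem n) _,
      ENNReal.tsum_const_eq_top_of_ne_zero one_ne_zero]
    exact le_top

theorem lintegral_firstVisit_lt_top {Ω S : Type*} [MeasurableSpace Ω] [MeasurableSpace S]
    {K : ℕ → S → Measure S} {P : Measure Ω} [IsFiniteMeasure P] {X : ℕ → Ω → S}
    (hX : IsMarkovChain K P X) {A : Set S} (hA : MeasurableSet A)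
    (h : Summable fun n => P.real {ω | ∀ k ≤ n, X k ω ∉ A}) :
    ∫⁻ ω, (firstVisit X A ω : ℝ≥0∞) ∂P < ⊤ := by
  have hm (n : ℕ) := (isPastEvent_avoid X n hA).measurableSet hX
  calc _ ≤ ∫⁻ ω, ∑' n, Set.indicator {ω | ∀ k ≤ n, X k ω ∉ A} (1 : Ω → ℝ≥0∞) ω ∂P :=
        lintegral_mono fun ω => firstVisit_le_tsum X A ω
    _ = ∑' n, P {ω | ∀ k ≤ n, X k ω ∉ A} := by
        rw [lintegral_tsum fun n => (measurable_one.indicator (hm n)).aemeasurable]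
        exact tsum_congr fun n => lintegral_indicator_one (hm n)
    _ = ENNReal.ofReal (∑' n, P.real {ω | ∀ k ≤ n, X k ω ∉ A}) := by
        rw [ENNReal.ofReal_tsum_of_nonneg (fun _ => measureReal_nonneg) h]
        exact tsum_congr fun n => (ofReal_measureReal).symm
    _ < ⊤ := ENNReal.ofReal_lt_top

/-- All `N` logarithms are at most `log (n + N + e)`, so the exponents add up to at most `N * o / C`
times it. -/
theorem rpow_neg_le_prod_exp {o C : ℝ} (ho : 0 ≤ o) (hC : N * o < C) {β : ℕ → ℝ}
    (hβ : ∀ n : ℕ, β n ≤ (1 / C) * Real.log ((n : ℝ) + Real.exp 1)) (n : ℕ) :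
    ((n : ℝ) + N + Real.exp 1) ^ (-(N * o / C)) ≤
      ∏ l ∈ Finset.range N, Real.exp (-(β (n + l) * o)) := by
  have hC0 : 0 < C := (by positivity : (0 : ℝ) ≤ N * o).trans_lt hC
  have he0 := Real.exp_pos 1
  have hx : 0 < (n : ℝ) + N + Real.exp 1 := by positivity
  rw [Real.rpow_def_of_pos hx, ← Real.exp_sum]
  refine Real.exp_le_exp.2 ?_
  set L := Real.log ((n : ℝ) + N + Real.exp 1)
  calc L * -(N * o / C) = ∑ _l ∈ Finset.range N, -((1 / C * L) * o) := by
        simp only [Finset.sum_const, Finset.card_range, nsmul_eq_mul]; ring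
    _ ≤ _ := by
        refine Finset.sum_le_sum fun l hl => neg_le_neg (mul_le_mul_of_nonneg_right ?_ ho)
        refine (hβ (n + l)).trans (mul_le_mul_of_nonneg_left ?_ (by positivity))
        refine Real.log_le_log (by positivity) ?_
        have : (l : ℝ) ≤ N := by exact_mod_cast (Finset.mem_range.1 hl).le
        push_cast
        linarith

end MaximinDesign

end

theorem mainTheorem3 {d N : ℕ} (hN : 2 ≤ N)
    (E : Set (MaximinDesign.Point d)) (hE : MeasurableSet E) (hEb : Bornology.IsBounded E)
    (hEpos : 0 < MeasureTheory.volume E)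
    (S : Matrix (Fin d) (Fin d) ℝ) (hS : S.PosDef)
    (γ : ℝ) (hγ : 0 < γ)
    (τ : ℕ → ℝ) (τmin τmax : ℝ) (hτmin : 0 < τmin) (hτ : ∀ n, τmin ≤ τ n ∧ τ n ≤ τmax)
    (C : ℝ) (hC : (N : ℝ) * MaximinDesign.osc E N < C)
    (β : ℕ → ℝ) (hβ0 : ∀ n, 0 ≤ β n)
    (hβ : ∀ n : ℕ, β n ≤ (1 / C) * Real.log ((n : ℝ) + Real.exp 1))
    {Ω : Type*} [MeasurableSpace Ω] (P : MeasureTheory.Measure Ω)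
    [MeasureTheory.IsProbabilityMeasure P]
    (X : ℕ → Ω → MaximinDesign.Config d N)
    (hX0 : ∀ᵐ ω ∂P, X 0 ω ∈ MaximinDesign.designs E N)
    (hX : MaximinDesign.IsMarkovChain
      (fun n => MaximinDesign.transition E S γ (β n) (τ n)) P X)
    (ε : ℝ) (hε : 0 < ε) :
    ∫⁻ ω, (MaximinDesign.firstVisit X (MaximinDesign.nearOptimal E N ε) ω : ENNReal) ∂P < ⊤ := by
  open MaximinDesign in
  obtain ⟨κ, hκ, hq⟩ := exists_le_proposalDensity hN hEb hS hγ hτmin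
  have hA := measurableSet_nearOptimal (N := N) hE ε
  set A := nearOptimal E N ε
  have hD := hX.ae_mem (measurableSet_designs hE) hX0 fun n x hx => transition_compl_designs hE hx
  have hstep (n : ℕ) (i : Fin N) : ∀ᵐ ω ∂P, ∀ A, MeasurableSet A →
      ENNReal.ofReal (Real.exp (-(β n * osc E N)) * κ) *
        volume.restrict E {y | Function.update (X n ω) i y ∈ A} ≤
          transition E S γ (β n) (τ n) (X n ω) A := by
    filter_upwards [hD n] with ω hω A hA
    rw [ENNReal.ofReal_mul (Real.exp_pos _).le]
    exact le_transition hN hE hEb (hβ0 n) hω i (hq (τ n) (hτ n).1 _ hω i) hA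
  have : IsFiniteMeasure ((volume : Measure (Point d)).restrict E) :=
    ⟨by simpa using volume_lt_top hEb⟩
  set V := (lebesgueDesigns E N A).toReal
  have hVtop := (lebesgueDesigns_lt_top hEb A).ne
  have hV : 0 < V := ENNReal.toReal_pos (lebesgueDesigns_nearOptimal_pos hE hEpos hε).ne' hVtop
  have ho := osc_nonneg (N := N) E
  have hC0 : 0 < C := (by positivity : (0 : ℝ) ≤ N * osc E N).trans_lt hC
  set p : ℕ → ℝ := fun n => P.real {ω | ∀ k ≤ n, X k ω ∉ A}
  have hrec (n : ℕ) : (κ ^ N * V) * ((n : ℝ) + N + Real.exp 1) ^ (-(N * osc E N / C)) * p n ≤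
      p n - p (n + N) := by
    have hpast := isPastEvent_avoid X n hA
    have h1 := hX.prod_mul_pi_mul_le hstep hA n hpast
    rw [Fintype.card_fin, ← lebesgueDesigns_eq_pi, ← ENNReal.ofReal_prod_of_nonneg
      fun _ _ => by positivity] at h1
    have h2 := ENNReal.toReal_mono (measure_ne_top _ _) h1
    rw [ENNReal.toReal_mul, ENNReal.toReal_mul, ENNReal.toReal_ofReal
      (Finset.prod_nonneg fun _ _ => by positivity), Finset.prod_mul_distrib, Finset.prod_const,
      Finset.card_range] at h2
    -- Avoiding `A` up to `n + N` and being in `A` at `n + N` are disjoint events, and both summands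
    -- lie in the event of avoiding `A` up to `n`.
    have h3 : p (n + N) + P.real (X (n + N) ⁻¹' A ∩ {ω | ∀ k ≤ n, X k ω ∉ A}) ≤ p n := by
      rw [← measureReal_union]
      · refine measureReal_mono (Set.union_subset (fun ω h k hk => h k (by omega))
          Set.inter_subset_right)
      · exact Set.disjoint_left.2 fun ω h h' => h (n + N) le_rfl h'.1
      · exact (hX.measurable _ hA).inter (hpast.measurableSet hX)
    have h4 := mul_le_mul_of_nonneg_right (rpow_neg_le_prod_exp ho hC hβ n)
      (by have : 0 ≤ p n := measureReal_nonneg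
          positivity : 0 ≤ κ ^ N * V * p n)
    calc _ = ((n : ℝ) + N + Real.exp 1) ^ (-(N * osc E N / C)) * (κ ^ N * V * p n) := by ring
      _ ≤ _ := h4
      _ = (∏ l ∈ Finset.range N, Real.exp (-(β (n + l) * osc E N))) * κ ^ N * (V * p n) := by ring
      _ ≤ _ := h2
      _ ≤ _ := le_sub_iff_add_le'.2 h3
  -- The assumption `C > N osc(U)` is decisive here: it puts the decay exponent below 1.
  obtain ⟨n₀, hn₀⟩ := exists_forall_le_mul_rpow (c := κ ^ N * V) (by positivity)
    ((div_lt_one hC0).2 hC) N hN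
  exact lintegral_firstVisit_lt_top hX hA
    (summable_of_shift_le (fun _ => measureReal_nonneg) (by omega) hrec hn₀)
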